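/- An ordered group $(G,<)$ is a group $G$ with a total order such that $x<y$ implies $zx<zy$ and $xz<yz$ for all $x,y,z\in G$; a group is orderable if it admits such an order. A subgroup $H$ of an ordered group is convex if $x,z\in H$ and $x<y<z$ imply $y\in H$; a convex jump is a pair $(N,H)$ of convex subgroups with $N\subsetneq H$ and no convex subgroup properly between them. The order is called central if $[H,G]\subseteq N$ for every convex jump $(N,H)$. Let $\mathcal C_2$ be the class of orderable groups $G$ such that every order that makes a two-generator subgroup of $G$ an ordered group is central (for that subgroup). Let $K$ be a skew field. A crossed product $K[\bar G;\sigma,\tau]$ is an associative ring containing $K$, with right $K$-basis $\bar G=\{\bar x : x\in G\}$ a copy of $G$, identity element $\bar 1$, and multiplication determined by $\bar x\bar y=\overline{xy}\,\tau(x,y)$ and $r\bar x=\bar x\,r^{\sigma(x)}$, where $\tau\colon G\times G\to K^\times$ and $\sigma\colon G\to \operatorname{Aut}(K)$ are maps. If $(G,<)$ is an ordered group, the Malcev--Neumann skew field $K((\bar G;\sigma,\tau,<))$ consists of the formal series $\sum_{x\in G}\bar x a_x$ ($a_x\in K$) with well-ordered support, with the multiplication extending that of $K[\bar G;\sigma,\tau]$,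 and $K(\bar G;\sigma,\tau)$ is its skew subfield generated by $K[\bar G;\sigma,\tau]$. **Corollary.** Let $(G,<)$ be an ordered group such that $G\notin\mathcal C_2$. Let $K$ be a skew field and $K[\bar G;\sigma,\tau]$ a crossed product. Then the skew field $D=K(\bar G;\sigma,\tau)$ contains a noncommutative free group algebra over its center $Z$; that is, there are a free group $F$ of rank at least two and an injective homomorphism of $Z$-algebras $Z[F]\to D$. -/

import Mathlib

universe u v

/-! ### Ordered groups -/

/-- The total order of `G` makes `G` an ordered group: it is compatible with left and right
multiplication. -/
class IsBiordered (G : Type v) [Group G] [LinearOrder G] : Prop where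
  mul_lt_left : ∀ x y z : G, x < y → z * x < z * y
  mul_lt_right : ∀ x y z : G, x < y → x * z < y * z

/-- A group is orderable if it carries a total order which makes it an ordered group. -/
def IsOrderable (G : Type v) [Group G] : Prop :=
  ∃ o : LinearOrder G, @IsBiordered G _ o

/-- A subgroup `H` is convex if `x, z ∈ H` and `x < y < z` imply `y ∈ H`. -/
def IsConvexSubgroup {G : Type v} [Group G] [LinearOrder G] (H : Subgroup G) : Prop :=
  ∀ x ∈ H, ∀ z ∈ H, ∀ y : G, x < y → y < z → y ∈ H

/-- `(N, H)` is a convex jump: `N` and `H` are convex, `N` is properly contained in `H`, and no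
convex subgroup lies properly between them. -/
def IsConvexJump {G : Type v} [Group G] [LinearOrder G] (N H : Subgroup G) : Prop :=
  IsConvexSubgroup N ∧ IsConvexSubgroup H ∧ N < H ∧
    ∀ L : Subgroup G, IsConvexSubgroup L → ¬ (N < L ∧ L < H)

/-- The order of `G` is central: `[H, G] ⊆ N` for all convex jumps `(N, H)`. -/
def IsCentralOrder (G : Type v) [Group G] [LinearOrder G] : Prop :=
  ∀ N H : Subgroup G, IsConvexJump N H → ⁅H, (⊤ : Subgroup G)⁆ ≤ N

/-- The class `C₂` of orderable groups in which every (group) order on every two-generator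
subgroup is central. -/
def InClassCTwo (G : Type v) [Group G] : Prop :=
  IsOrderable G ∧
    ∀ (a b : G) (o : LinearOrder (Subgroup.closure ({a, b} : Set G))),
      @IsBiordered (Subgroup.closure ({a, b} : Set G)) _ o →
        @IsCentralOrder (Subgroup.closure ({a, b} : Set G)) _ o

namespace IsBiordered

variable {G : Type v} [Group G] [LinearOrder G] [IsBiordered G]

instance : MulLeftStrictMono G := ⟨fun z x y h => IsBiordered.mul_lt_left x y z h⟩

instance : MulRightStrictMono G := ⟨fun z x y h => IsBiordered.mul_lt_right x y z h⟩

instance : MulLeftMono G := mulLeftMono_of_mulLeftStrictMono G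

instance : MulRightMono G := mulRightMono_of_mulRightStrictMono G

theorem finite_antidiag {s t : Set G} (hs : s.IsWF) (ht : t.IsWF) (x : G) :
    {y : G | y ∈ s ∧ y⁻¹ * x ∈ t}.Finite := by
  by_contra h
  have h' : {y : G | y ∈ s ∧ y⁻¹ * x ∈ t}.Infinite := h
  obtain ⟨g, hg⟩ := hs.isPWO.exists_monotone_subseq
    (f := fun n => (h'.natEmbedding _ n : G)) (fun n => (h'.natEmbedding _ n).2.1)
  obtain ⟨m, n, mn, hle⟩ := ht.isPWO
    (fun n => ⟨(h'.natEmbedding _ (g n) : G)⁻¹ * x, (h'.natEmbedding _ (g n)).2.2⟩)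
  have hle1 : (h'.natEmbedding _ (g m) : G)⁻¹ * x ≤ (h'.natEmbedding _ (g n) : G)⁻¹ * x := hle
  have h1 : (h'.natEmbedding _ (g n) : G) ≤ (h'.natEmbedding _ (g m) : G) :=
    inv_le_inv_iff.1 ((mul_le_mul_iff_right x).1 hle1)
  have h2 : (h'.natEmbedding _ (g m) : G) ≤ (h'.natEmbedding _ (g n) : G) := hg mn.le
  exact mn.ne (g.injective ((h'.natEmbedding _).injective (Subtype.ext (le_antisymm h2 h1))))

open scoped Pointwise in
theorem isWF_mul {s t : Set G} (hs : s.IsWF) (ht : t.IsWF) : (s * t).IsWF := by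
  rw [← Set.image_mul_prod]
  exact ((hs.isPWO.prod ht.isPWO).image_of_monotone (monotone_fst.mul' monotone_snd)).isWF

theorem isWF_closure {s : Set G} (hs : s.IsWF) (hpos : ∀ x ∈ s, 1 ≤ x) :
    (Submonoid.closure s : Set G).IsWF := by
  refine Set.IsPWO.isWF ?_
  rw [Submonoid.closure_eq_image_prod]
  refine (hs.isPWO.partiallyWellOrderedOn_sublistForall₂ (· ≤ ·)).image_of_monotone_on ?_
  exact fun l1 _ l2 hl2 h12 => h12.prod_le_prod' fun x hx => hpos x <| hl2 x hx

end IsBiordered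

/-! ### Crossed products and Malcev-Neumann series -/

/-- The data `(σ, τ)` of a crossed product `K[Ḡ; σ, τ]`: the action `r x̄ = x̄ σ(x)(r)` and the
twisting `x̄ ȳ = (xy)‾ τ(x, y)`.  The fields `twist` and `cocycle` say that this multiplication is
associative; `normalized` says that `1̄` is the identity element. -/
structure CrossedSystem (K : Type u) [DivisionRing K] (G : Type v) [Group G] where
  σ : G → (K ≃+* K)
  τ : G → G → Kˣ
  twist : ∀ (x y : G) (r : K), (τ x y : K) * σ y (σ x r) = σ (x * y) r * (τ x y : K)
  cocycle : ∀ x y z : G,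
    (τ (x * y) z : K) * σ z (τ x y : K) = (τ x (y * z) : K) * (τ y z : K)
  normalized : τ 1 1 = 1

namespace CrossedSystem

variable {K : Type u} [DivisionRing K] {G : Type v} [Group G] (S : CrossedSystem K G)

theorem τ_one_left (x : G) : S.τ 1 x = 1 := by
  have h := S.cocycle 1 1 x
  simp only [S.normalized, one_mul, Units.val_one, map_one, mul_one] at h
  have h2 : S.τ 1 x * 1 = S.τ 1 x * S.τ 1 x := by
    ext; simpa using h
  exact (mul_left_cancel h2).symm

theorem τ_one_right (x : G) : S.τ x 1 = 1 := by
  have h := S.cocycle x 1 1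
  simp only [S.normalized, mul_one, Units.val_one] at h
  have h2 : S.σ 1 (S.τ x 1 : K) = 1 :=
    mul_left_cancel₀ (S.τ x 1).ne_zero (h.trans (mul_one _).symm)
  ext
  exact (S.σ 1).injective (by rw [h2, Units.val_one, map_one])

theorem σ_one (r : K) : S.σ 1 r = r := by
  have h := S.twist 1 1 r
  simp only [S.normalized, mul_one, one_mul, Units.val_one] at h
  exact (S.σ 1).injective h

/-- The `y`-th summand of the `x`-th coefficient of the product of `∑ x̄ aₓ` and `∑ x̄ bₓ`, namely
`τ(y, z) σ(z)(a_y) b_z`, where `z = y⁻¹ x`. -/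
def mulTerm (a b : G → K) (x y : G) : K :=
  (S.τ y (y⁻¹ * x) : K) * S.σ (y⁻¹ * x) (a y) * b (y⁻¹ * x)

theorem mulTerm_ne_zero {S : CrossedSystem K G} {a b : G → K} {x y : G} :
    S.mulTerm a b x y ≠ 0 ↔ a y ≠ 0 ∧ b (y⁻¹ * x) ≠ 0 := by
  simp [mulTerm]

theorem exists_mulTerm_ne_zero {S : CrossedSystem K G} {a b : G → K} {x : G}
    (h : ∑ᶠ y, S.mulTerm a b x y ≠ 0) : ∃ y, S.mulTerm a b x y ≠ 0 := by
  by_contra hy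
  push Not at hy
  exact h (finsum_eq_zero_of_forall_eq_zero hy)

end CrossedSystem

/-- The set `K((Ḡ; σ, τ, <))` of Malcev-Neumann series `∑ x̄ aₓ` with well-ordered support. -/
@[ext]
structure MNSeries {K : Type u} [DivisionRing K] {G : Type v} [Group G] [LinearOrder G]
    (S : CrossedSystem K G) where
  coeff : G → K
  isWF_support : (Function.support coeff).IsWF

noncomputable section

namespace MNSeries

open CrossedSystem

variable {K : Type u} [DivisionRing K] {G : Type v} [Group G] [LinearOrder G]
  {S : CrossedSystem K G}

instance : Zero (MNSeries S) := ⟨⟨0, by simp⟩⟩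

instance : Add (MNSeries S) :=
  ⟨fun f g => ⟨f.coeff + g.coeff,
    (f.isWF_support.union g.isWF_support).mono (Function.support_add _ _)⟩⟩

instance : Neg (MNSeries S) :=
  ⟨fun f => ⟨-f.coeff, by rw [Function.support_neg]; exact f.isWF_support⟩⟩

@[simp] theorem coeff_zero (x : G) : (0 : MNSeries S).coeff x = 0 := rfl

@[simp] theorem coeff_add (f g : MNSeries S) (x : G) :
    (f + g).coeff x = f.coeff x + g.coeff x := rfl

@[simp] theorem coeff_neg (f : MNSeries S) (x : G) : (-f).coeff x = -f.coeff x := rfl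

/-- The series `x̄ a`. -/
def single (S : CrossedSystem K G) (x : G) (a : K) : MNSeries S :=
  ⟨Pi.single x a, (Set.finite_singleton x).isWF.mono Pi.support_single_subset⟩

theorem coeff_single (x : G) (a : K) (y : G) :
    (single S x a).coeff y = if y = x then a else 0 := by
  simp [single, Pi.single_apply]

@[simp] theorem coeff_single_same (x : G) (a : K) : (single S x a).coeff x = a := by
  simp [coeff_single]

instance : One (MNSeries S) := ⟨single S 1 1⟩

theorem one_def : (1 : MNSeries S) = single S 1 1 := rfl

variable [IsBiordered G]

theorem finite_mulTerm (f g : MNSeries S) (x : G) :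
    (Function.support (mulTerm S f.coeff g.coeff x)).Finite :=
  (IsBiordered.finite_antidiag f.isWF_support g.isWF_support x).subset
    fun _ hy => mulTerm_ne_zero.1 hy

/-- `(∑ x̄ aₓ)(∑ x̄ bₓ) = ∑ x̄ (∑_{yz = x} τ(y, z) σ(z)(a_y) b_z)`. -/
instance : Mul (MNSeries S) :=
  ⟨fun f g => ⟨fun x => ∑ᶠ y, mulTerm S f.coeff g.coeff x y, by
    refine (IsBiordered.isWF_mul f.isWF_support g.isWF_support).mono fun x hx => ?_
    obtain ⟨y, hy⟩ := exists_mulTerm_ne_zero hx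
    obtain ⟨h1, h2⟩ := mulTerm_ne_zero.1 hy
    exact ⟨y, h1, y⁻¹ * x, h2, by simp⟩⟩⟩

theorem coeff_mul (f g : MNSeries S) (x : G) :
    (f * g).coeff x = ∑ᶠ y, mulTerm S f.coeff g.coeff x y := rfl

theorem coeff_single_mul (s : G) (a : K) (f : MNSeries S) (x : G) :
    (single S s a * f).coeff x =
      (S.τ s (s⁻¹ * x) : K) * S.σ (s⁻¹ * x) a * f.coeff (s⁻¹ * x) := by
  rw [coeff_mul, finsum_eq_single _ s]
  · simp [mulTerm]
  · intro y hy
    simp [mulTerm, coeff_single, hy]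

theorem coeff_mul_single (s : G) (a : K) (f : MNSeries S) (x : G) :
    (f * single S s a).coeff x =
      (S.τ (x * s⁻¹) s : K) * S.σ s (f.coeff (x * s⁻¹)) * a := by
  rw [coeff_mul, finsum_eq_single _ (x * s⁻¹)]
  · simp [mulTerm]
  · intro y hy
    have : y⁻¹ * x ≠ s := by
      rintro rfl
      simp at hy
    simp [mulTerm, coeff_single, this]

theorem mul_assoc_aux (f g h : MNSeries S) : f * g * h = f * (g * h) := by
  ext x
  have hterm : ∀ a w : G,
      (S.τ w (w⁻¹ * x) : K) * S.σ (w⁻¹ * x) (mulTerm S f.coeff g.coeff w a) * h.coeff (w⁻¹ * x)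
        = (S.τ a (a⁻¹ * x) : K) * S.σ (a⁻¹ * x) (f.coeff a) *
            mulTerm S g.coeff h.coeff (a⁻¹ * x) (a⁻¹ * w) := by
    intro a w
    obtain ⟨b, rfl⟩ : ∃ b, w = a * b := ⟨a⁻¹ * w, by simp⟩
    obtain ⟨c, rfl⟩ : ∃ c, x = a * b * c := ⟨(a * b)⁻¹ * x, by group⟩
    have e1 : (a * b)⁻¹ * (a * b * c) = c := by group
    have e2 : a⁻¹ * (a * b * c) = b * c := by group
    have e3 : a⁻¹ * (a * b) = b := by group
    have e4 : b⁻¹ * (b * c) = c := by group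
    simp only [mulTerm, e1, e2, e3, e4, map_mul]
    have k1 := S.cocycle a b c
    have k2 := S.twist b c (f.coeff a)
    calc (S.τ (a * b) c : K) * (S.σ c (S.τ a b : K) * S.σ c (S.σ b (f.coeff a)) *
            S.σ c (g.coeff b)) * h.coeff c
        = ((S.τ (a * b) c : K) * S.σ c (S.τ a b : K)) * S.σ c (S.σ b (f.coeff a)) *
            S.σ c (g.coeff b) * h.coeff c := by simp only [mul_assoc]
      _ = (S.τ a (b * c) : K) * ((S.τ b c : K) * S.σ c (S.σ b (f.coeff a))) *
            S.σ c (g.coeff b) * h.coeff c := by rw [k1]; simp only [mul_assoc]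
      _ = _ := by rw [k2]; simp only [mul_assoc]
  let F : G × G → K := fun p =>
    (S.τ p.1 (p.1⁻¹ * x) : K) * S.σ (p.1⁻¹ * x) (mulTerm S f.coeff g.coeff p.1 p.2) *
      h.coeff (p.1⁻¹ * x)
  have hF : (Function.support F).Finite := by
    have hfin : (⋃ w ∈ {w : G | w ∈ {w | ∃ a, mulTerm S f.coeff g.coeff w a ≠ 0} ∧
        w⁻¹ * x ∈ Function.support h.coeff},
        (fun a => (w, a)) '' Function.support (mulTerm S f.coeff g.coeff w)).Finite := by
      refine Set.Finite.biUnion ?_ fun w _ => (finite_mulTerm f g w).image _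
      refine IsBiordered.finite_antidiag ?_ h.isWF_support x
      refine (IsBiordered.isWF_mul f.isWF_support g.isWF_support).mono ?_
      rintro w ⟨a, ha⟩
      obtain ⟨h1, h2⟩ := mulTerm_ne_zero.1 ha
      exact ⟨a, h1, a⁻¹ * w, h2, by simp⟩
    refine hfin.subset ?_
    rintro ⟨w, a⟩ hp
    have hp' : F (w, a) ≠ 0 := hp
    have h1 : mulTerm S f.coeff g.coeff w a ≠ 0 := by
      intro h0; apply hp'; simp [F, h0]
    have h2 : h.coeff (w⁻¹ * x) ≠ 0 := by
      intro h0; apply hp'; simp [F, h0]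
    simp only [Set.mem_iUnion]
    exact ⟨w, ⟨⟨a, h1⟩, h2⟩, ⟨a, h1, rfl⟩⟩
  have hL : (f * g * h).coeff x = ∑ᶠ p, F p := by
    rw [finsum_curry F hF, coeff_mul]
    refine finsum_congr fun w => ?_
    simp only [F]
    rw [← finsum_mul, ← mul_finsum, ← AddEquivClass.map_finsum]
    rfl
  have hF' : (Function.support (F ∘ (Equiv.prodComm G G))).Finite := by
    have := hF.preimage (f := Equiv.prodComm G G) (Equiv.injective _).injOn
    exact this
  have hR : (f * (g * h)).coeff x = ∑ᶠ p, (F ∘ (Equiv.prodComm G G)) p := by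
    rw [finsum_curry _ hF', coeff_mul]
    refine finsum_congr fun a => ?_
    have e : (g * h).coeff (a⁻¹ * x) =
        ∑ᶠ w, mulTerm S g.coeff h.coeff (a⁻¹ * x) (a⁻¹ * w) := by
      rw [coeff_mul]
      exact (finsum_comp_equiv (Equiv.mulLeft a⁻¹)
        (f := mulTerm S g.coeff h.coeff (a⁻¹ * x))).symm
    rw [mulTerm, e, mul_finsum]
    exact finsum_congr fun w => (hterm a w).symm
  rw [hL, hR]
  exact (finsum_comp_equiv (Equiv.prodComm G G)).symm

instance : Ring (MNSeries S) where
  add_assoc f g h := by ext x; simp [add_assoc]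
  zero_add f := by ext x; simp
  add_zero f := by ext x; simp
  add_comm f g := by ext x; simp [add_comm]
  neg_add_cancel f := by ext x; simp
  nsmul := nsmulRec
  zsmul := zsmulRec
  mul_assoc := mul_assoc_aux
  one_mul f := by ext x; simp [one_def, coeff_single_mul, S.τ_one_left]
  mul_one f := by ext x; simp [one_def, coeff_mul_single, S.τ_one_right, S.σ_one]
  zero_mul f := by ext x; simp [coeff_mul, mulTerm]
  mul_zero f := by ext x; simp [coeff_mul, mulTerm]
  left_distrib f g h := by
    ext x
    simp only [coeff_add, coeff_mul]
    rw [← finsum_add_distrib (finite_mulTerm f g x) (finite_mulTerm f h x)]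
    exact finsum_congr fun y => by simp [mulTerm, mul_add]
  right_distrib f g h := by
    ext x
    simp only [coeff_add, coeff_mul]
    rw [← finsum_add_distrib (finite_mulTerm f h x) (finite_mulTerm g h x)]
    exact finsum_congr fun y => by simp [mulTerm, mul_add, add_mul]

instance : Nontrivial (MNSeries S) :=
  ⟨⟨0, 1, fun h => by simpa [one_def] using congrArg (fun f => f.coeff 1) h⟩⟩

/-- A nonzero series has a right inverse: its coefficients are found by recursion along a
well-ordered set which contains its support. -/
theorem exists_mul_eq_one (f : MNSeries S) (hf : f ≠ 0) : ∃ g : MNSeries S, f * g = 1 := by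
  classical
  have hne : (Function.support f.coeff).Nonempty := by
    by_contra h
    rw [Set.not_nonempty_iff_eq_empty, Function.support_eq_empty_iff] at h
    exact hf (MNSeries.ext h)
  set s₀ := f.isWF_support.min hne with hs₀
  have hs₀mem : f.coeff s₀ ≠ 0 := f.isWF_support.min_mem hne
  have hmin : ∀ s, f.coeff s ≠ 0 → s₀ ≤ s := fun s hs => f.isWF_support.min_le hne hs
  let P : Set G := (fun s => s₀⁻¹ * s) '' Function.support f.coeff
  have hP : P.IsWF :=
    (f.isWF_support.isPWO.image_of_monotone fun a b h => mul_le_mul_right h _).isWF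
  have hP1 : ∀ p ∈ P, 1 ≤ p := by
    rintro _ ⟨s, hs, rfl⟩
    exact le_inv_mul_iff_mul_le.2 (by simpa using hmin s hs)
  let W : Set G := (fun t => t * s₀⁻¹) '' (Submonoid.closure P : Set G)
  have hW : W.IsWF :=
    ((IsBiordered.isWF_closure hP hP1).isPWO.image_of_monotone
      fun a b h => mul_le_mul_left h _).isWF
  have hWP : ∀ s w, f.coeff s ≠ 0 → s⁻¹ * s₀ * w ∈ W → w ∈ W := by
    rintro s w hs ⟨t, ht, hts⟩
    refine ⟨s₀⁻¹ * s * t, Submonoid.mul_mem _ (Submonoid.subset_closure ⟨s, hs, rfl⟩) ht, ?_⟩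
    have hts' : t * s₀⁻¹ = s⁻¹ * s₀ * w := hts
    simp only [mul_assoc] at hts' ⊢
    rw [hts']
    group
  have hW0 : s₀⁻¹ ∈ W := ⟨1, Submonoid.one_mem _, by simp⟩
  have hwf : WellFounded fun a b : G => a < b ∧ a ∈ W ∧ b ∈ W :=
    Set.wellFoundedOn_iff.1 hW
  let rec_step : (w : G) → ((v : G) → (v < w ∧ v ∈ W ∧ w ∈ W) → K) → K := fun w G' =>
    if w ∈ W then
      ((S.τ s₀ w : K) * S.σ w (f.coeff s₀))⁻¹ *
        ((if s₀ * w = 1 then 1 else 0) -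
          ∑ᶠ s : G, if h : s ≠ s₀ ∧ (s⁻¹ * s₀ * w < w ∧ s⁻¹ * s₀ * w ∈ W ∧ w ∈ W) then
            (S.τ s (s⁻¹ * s₀ * w) : K) * S.σ (s⁻¹ * s₀ * w) (f.coeff s) * G' _ h.2 else 0)
    else 0
  let c : G → K := hwf.fix rec_step
  have hc : ∀ w, c w = rec_step w fun v _ => c v := fun w => hwf.fix_eq _ w
  have hcW : ∀ w, w ∉ W → c w = 0 := fun w hw => by rw [hc]; simp [rec_step, hw]
  let g : MNSeries S := ⟨c, hW.mono fun w hw => by by_contra h; exact hw (hcW w h)⟩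
  refine ⟨g, ?_⟩
  ext x
  obtain ⟨w, rfl⟩ : ∃ w, x = s₀ * w := ⟨s₀⁻¹ * x, by simp⟩
  rw [one_def, coeff_single]
  by_cases hw : w ∈ W
  · have hsum : (f * g).coeff (s₀ * w) = mulTerm S f.coeff c (s₀ * w) s₀ +
        ∑ᶠ s : G, if s ≠ s₀ then mulTerm S f.coeff c (s₀ * w) s else 0 := by
      rw [coeff_mul, ← add_finsum_cond_ne s₀ (finite_mulTerm f g (s₀ * w))]
      congr 1
      exact finsum_congr fun s => by
        by_cases h : s = s₀ <;> simp [h, g]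
    have hterm : ∀ s : G, (if s ≠ s₀ then mulTerm S f.coeff c (s₀ * w) s else 0) =
        if h : s ≠ s₀ ∧ (s⁻¹ * s₀ * w < w ∧ s⁻¹ * s₀ * w ∈ W ∧ w ∈ W) then
            (S.τ s (s⁻¹ * s₀ * w) : K) * S.σ (s⁻¹ * s₀ * w) (f.coeff s) * c (s⁻¹ * s₀ * w)
          else 0 := by
      intro s
      by_cases h1 : s = s₀
      · simp [h1]
      by_cases h2 : f.coeff s = 0
      · simp [h2, mulTerm]
      by_cases h3 : s⁻¹ * s₀ * w ∈ W
      · have h4 : s⁻¹ * s₀ * w < w := by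
          have : s⁻¹ * s₀ < 1 := by
            rw [inv_mul_lt_iff_lt_mul, mul_one]
            exact lt_of_le_of_ne (hmin s h2) (Ne.symm h1)
          simpa using mul_lt_mul_left this w
        rw [if_pos h1, dif_pos ⟨h1, h4, h3, hw⟩, mulTerm, ← mul_assoc s⁻¹]
      · rw [if_pos h1, dif_neg (fun h => h3 h.2.2.1), mulTerm, ← mul_assoc s⁻¹, hcW _ h3,
          mul_zero]
    have hlead : mulTerm S f.coeff c (s₀ * w) s₀ =
        (S.τ s₀ w : K) * S.σ w (f.coeff s₀) * c w := by
      simp [mulTerm]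
    have hunit : (S.τ s₀ w : K) * S.σ w (f.coeff s₀) ≠ 0 := by simp [hs₀mem]
    rw [hsum, hlead, finsum_congr hterm, hc w]
    simp only [rec_step, if_pos hw]
    rw [mul_inv_cancel_left₀ hunit, sub_add_cancel]
  · have hx : s₀ * w ≠ 1 := by
      intro h
      apply hw
      rw [eq_inv_of_mul_eq_one_right h]
      exact hW0
    rw [if_neg hx, coeff_mul]
    refine finsum_eq_zero_of_forall_eq_zero fun s => ?_
    by_contra h
    obtain ⟨h1, h2⟩ := mulTerm_ne_zero.1 h
    refine hw (hWP s w h1 ?_)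
    by_contra h3
    exact h2 (by rw [← mul_assoc]; exact hcW _ h3)

open Classical in
instance : Inv (MNSeries S) :=
  ⟨fun f => if h : f = 0 then 0 else (exists_mul_eq_one f h).choose⟩

/-- The Malcev-Neumann series ring over a skew field is a skew field. -/
instance : DivisionRing (MNSeries S) where
  mul_inv_cancel f hf := by
    have h : f⁻¹ = (exists_mul_eq_one f hf).choose := dif_neg hf
    rw [h]
    exact (exists_mul_eq_one f hf).choose_spec
  inv_zero := dif_pos rfl
  nnqsmul := _
  nnqsmul_def _ _ := rfl
  qsmul := _
  qsmul_def _ _ := rfl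

/-- The twisting `x̄ ȳ = (xy)‾ τ(x, y)`, with coefficients. -/
theorem single_mul_single (x y : G) (a b : K) :
    single S x a * single S y b = single S (x * y) ((S.τ x y : K) * S.σ y a * b) := by
  ext z
  rw [coeff_single_mul, coeff_single, coeff_single]
  by_cases h : z = x * y
  · subst h; simp
  · have : x⁻¹ * z ≠ y := by rintro rfl; simp at h
    simp [h, this]

/-- The action `r x̄ = x̄ σ(x)(r)`. -/
theorem scalar_mul_bar (x : G) (r : K) :
    single S 1 r * single S x 1 = single S x 1 * single S 1 (S.σ x r) := by
  simp [single_mul_single, S.τ_one_left, S.τ_one_right]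

end MNSeries

namespace CrossedSystem

variable {K : Type u} [DivisionRing K] {G : Type v} [Group G] [LinearOrder G] [IsBiordered G]

open scoped Pointwise in
/-- The crossed product `K[Ḡ; σ, τ]`, as the subring of the finite sums `∑ x̄ rₓ` inside the
Malcev-Neumann series ring. -/
def crossedProduct (S : CrossedSystem K G) : Subring (MNSeries S) where
  carrier := {f | (Function.support f.coeff).Finite}
  mul_mem' {f g} hf hg := by
    refine (Set.Finite.mul hf hg).subset fun x hx => ?_
    obtain ⟨y, hy⟩ := exists_mulTerm_ne_zero hx
    obtain ⟨h1, h2⟩ := mulTerm_ne_zero.1 hy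
    exact ⟨y, h1, y⁻¹ * x, h2, by simp⟩
  one_mem' := (Set.finite_singleton (1 : G)).subset Pi.support_single_subset
  add_mem' {f g} hf hg := (Set.Finite.union hf hg).subset (Function.support_add _ _)
  zero_mem' := by
    change (Function.support (0 : G → K)).Finite
    simp
  neg_mem' {f} hf := by
    change (Function.support (-f.coeff)).Finite
    rw [Function.support_neg]
    exact hf

/-- The Malcev-Neumann skew field of fractions `K(Ḡ; σ, τ)`: the skew subfield of
`K((Ḡ; σ, τ, <))` generated by `K[Ḡ; σ, τ]`. -/
def skewFractions (S : CrossedSystem K G) : Subfield (MNSeries S) :=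
  Subfield.closure (S.crossedProduct : Set (MNSeries S))

end CrossedSystem

/-- The skew field `D`, with center `Z`, contains a noncommutative free group algebra over `Z`:
for some free group `H` of rank at least two, there is an injective homomorphism of `Z`-algebras
from the group algebra `Z[H]` to `D`. -/
def ContainsFreeGroupAlgebraOverCenter (D : Type u) [DivisionRing D] : Prop :=
  ∃ X : Type, Nontrivial X ∧
    ∃ φ : MonoidAlgebra (Subring.center D) (FreeGroup X) →ₐ[Subring.center D] D,
      Function.Injective φ

end

/-! ### Free pairs in ordered groups -/

section OrderedGroup

variable {G : Type v} [Group G] [LinearOrder G] [IsBiordered G]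

/-! The proof joins a dynamical fact about ordered groups to a support argument for series.

If an order is not central, some `h > 1` has a conjugate `g * h * g⁻¹` exceeding `h * h`
(`isCentralOrder_of_conj_le`). With `k = g⁻¹`, the elements `k` and `h * k` then freely generate a
submonoid (`IsFreePair.of_conj_lt`). Freeness does not depend on the order, so a pair found for some
order on a two-generator subgroup serves in `G`, where it is modified into a pair `x, y > 1`.

The free generators in `D` are `1 + x̄` and `1 + ȳ`. A central element of `D` commutes with every
`ḡ`, so its support lies in the center of `G` (`mem_center_of_commute_bar`). Hence the image of
`Z[F]` is supported in `P`, the products of central elements and words in `x`, `y`. The sets `x P`,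
`y P` and the center of `G` are pairwise disjoint, so a relation `s + x̄ a + ȳ b = 0` with `s ∈ Z`
and `a`, `b` in the image is trivial. Fox's formula `α = s + ∑ (tᵢ - 1) βᵢ` turns this independence
into injectivity, by induction on the words that occur in `α` (`freeGroupAlgebra_injective`). -/

/-- An order such that no conjugate of an element `h > 1` exceeds `h ^ 2` is central. -/
theorem isCentralOrder_of_conj_le (hc : ∀ g h : G, 1 < h → g * h * g⁻¹ ≤ h * h) :
    IsCentralOrder G := by
  have hconj : ∀ g h : G, 1 < h → 1 < g * h * g⁻¹ := fun g h hh => by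
    simpa using mul_lt_mul_left (mul_lt_mul_right hh g) g⁻¹
  -- Convex subgroups are normal, because `g * h * g⁻¹` is trapped between `1` and `h * h`.
  have hnormal : ∀ L : Subgroup G, IsConvexSubgroup L → ∀ g, ∀ h ∈ L, g * h * g⁻¹ ∈ L := by
    intro L hL g
    have hpos : ∀ h ∈ L, 1 < h → g * h * g⁻¹ ∈ L := fun h hh h1 => by
      rcases (hc g h h1).eq_or_lt with he | hl
      · exact he ▸ mul_mem hh hh
      · exact hL 1 (one_mem _) _ (mul_mem hh hh) _ (hconj g h h1) hl
    intro h hh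
    rcases lt_trichotomy h 1 with h1 | rfl | h1
    · simpa [mul_assoc] using inv_mem (hpos h⁻¹ (inv_mem hh) (one_lt_inv'.2 h1))
    · simp
    · exact hpos h hh h1
  intro N H hNH
  obtain ⟨hN, hH, hlt, hbetween⟩ := hNH
  have hle : ∀ c ∈ H, 1 < c → c ∉ N → ∀ h ∈ H, ∃ n : ℕ, h ≤ c ^ n := by
    intro c hcH hc1 hcN h hh
    -- The convex subgroup generated by `c`. It strictly contains `N`, so if `h` exceeded all powers
    -- of `c` it would lie strictly inside the jump.
    let L : Subgroup G :=
      { carrier := {y | ∃ n : ℕ, y ≤ c ^ n ∧ y⁻¹ ≤ c ^ n}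
        one_mem' := ⟨0, by simp⟩
        inv_mem' := by rintro y ⟨n, h1, h2⟩; exact ⟨n, h2, by simpa using h1⟩
        mul_mem' := by
          rintro y z ⟨n, h1, h2⟩ ⟨m, h3, h4⟩
          refine ⟨n + m, ?_, ?_⟩
          · rw [pow_add]; exact mul_le_mul' h1 h3
          · rw [mul_inv_rev, add_comm, pow_add]; exact mul_le_mul' h4 h2 }
    have hL : IsConvexSubgroup L := by
      rintro x ⟨n, h1, h2⟩ z ⟨m, h3, h4⟩ y hxy hyz
      refine ⟨n + m, ?_, ?_⟩
      · exact (hyz.le.trans h3).trans (pow_le_pow_right' hc1.le (by omega))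
      · exact ((inv_lt_inv_iff.2 hxy).le.trans h2).trans (pow_le_pow_right' hc1.le (by omega))
    have hcL : c ∈ L := ⟨1, by simp, by simpa using (inv_lt_one'.2 hc1).le.trans hc1.le⟩
    have hbd : ∀ y ∈ N, y ≤ c := fun y hy => by
      by_contra hlt'
      exact hcN (hN 1 (one_mem _) y hy c hc1 (not_le.1 hlt'))
    have hNL : N < L := by
      refine lt_of_le_of_ne (fun y hy => ⟨1, ?_, ?_⟩) (fun he => hcN (he ▸ hcL))
      · simpa using hbd y hy
      · simpa using hbd _ (inv_mem hy)
    by_contra hno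
    push Not at hno
    have hhL : h ∉ L := by
      rintro ⟨n, h1, -⟩
      exact absurd h1 (not_le.2 (hno n))
    refine hbetween L hL ⟨hNL, lt_of_le_of_ne ?_ fun he => hhL (he ▸ hh)⟩
    rintro y ⟨n, h1, h2⟩
    have e1 : y < h := h1.trans_lt (hno n)
    have e2 : h⁻¹ < y := inv_lt_of_inv_lt' (h2.trans_lt (hno n))
    exact hH _ (inv_mem hh) _ hh _ e2 e1
  have key : ∀ g h c : G, h ∈ H → 1 < h → g * h * g⁻¹ = h * c → 1 < c → c ∈ N := by
    intro g h c hh h1 hghc hc1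
    by_contra hcN
    have hcH : c ∈ H := by
      have : c = h⁻¹ * (g * h * g⁻¹) := by rw [hghc]; group
      rw [this]
      exact mul_mem (inv_mem hh) (hnormal H hH g h hh)
    obtain ⟨n, hn⟩ := hle c hcH hc1 hcN h hh
    -- Write `cᵢ` for the conjugate of `c` by `g ^ i`. The hypothesis, applied to `cᵢ` and `(g ^
    -- i)⁻¹`, bounds `c` by `cᵢ * cᵢ`, so `c ≤ cᵢ * cᵢ₊₁` whichever factor is smaller. Conjugating
    -- `h` by `g ^ (2 * k)` appends `2 * k` such factors, worth at least `c ^ k`. As the result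
    -- stays below `h * h`, all powers of `c` would be at most `h`.
    have hsq : ∀ i : ℕ, c ≤ (g ^ i * c * (g ^ i)⁻¹) * (g ^ i * c * (g ^ i)⁻¹) := fun i => by
      simpa [mul_assoc] using hc (g ^ i)⁻¹ _ (hconj (g ^ i) c hc1)
    have hpair : ∀ i : ℕ, c ≤ (g ^ i * c * (g ^ i)⁻¹) *
        (g ^ (i + 1) * c * (g ^ (i + 1))⁻¹) := fun i => by
      rcases le_total (g ^ i * c * (g ^ i)⁻¹) (g ^ (i + 1) * c * (g ^ (i + 1))⁻¹) with h2 | h2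
      · exact (hsq i).trans (mul_le_mul_right h2 _)
      · exact (hsq (i + 1)).trans (mul_le_mul_left h2 _)
    have hstep : ∀ i : ℕ, g ^ (i + 1) * h * (g ^ (i + 1))⁻¹ =
        (g ^ i * h * (g ^ i)⁻¹) * (g ^ i * c * (g ^ i)⁻¹) := fun i => by
      calc g ^ (i + 1) * h * (g ^ (i + 1))⁻¹ = g ^ i * (g * h * g⁻¹) * (g ^ i)⁻¹ := by
            rw [pow_succ]; group
        _ = _ := by rw [hghc]; group
    have hgrow : ∀ k : ℕ, h * c ^ k ≤ g ^ (2 * k) * h * (g ^ (2 * k))⁻¹ := by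
      intro k
      induction k with
      | zero => simp
      | succ k ih =>
        rw [show 2 * (k + 1) = 2 * k + 1 + 1 by ring, hstep, hstep, mul_assoc _ (_ * c * _),
          pow_succ, ← mul_assoc]
        exact mul_le_mul' ih (hpair (2 * k))
    have h3 : h * c ^ (n + 1) ≤ h * h := (hgrow (n + 1)).trans (hc _ h h1)
    have h4 : c ^ (n + 1) ≤ c ^ n := (le_of_mul_le_mul_left' h3).trans hn
    rw [pow_succ] at h4
    exact absurd h4 (not_le.2 (by simpa using mul_lt_mul_right hc1 (c ^ n)))
  have hpos : ∀ g h : G, h ∈ H → 1 < h → h⁻¹ * (g * h * g⁻¹) ∈ N := by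
    intro g h hh h1
    rcases lt_trichotomy (h⁻¹ * (g * h * g⁻¹)) 1 with h2 | h2 | h2
    -- When conjugation decreases `h`, exchange `h` with its conjugate and `g` with its inverse.
    · have := key g⁻¹ (g * h * g⁻¹) (h⁻¹ * (g * h * g⁻¹))⁻¹ (hnormal H hH g h hh) (hconj g h h1)
        (by group) (one_lt_inv'.2 h2)
      simpa using inv_mem this
    · rw [h2]; exact one_mem _
    · exact key g h _ hh h1 (by group) h2
  rw [Subgroup.commutator_le]
  intro h hh g _
  rcases lt_trichotomy h 1 with h1 | rfl | h1
  · have := hpos g h⁻¹ (inv_mem hh) (one_lt_inv'.2 h1)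
    simpa [commutatorElement_def, mul_assoc] using this
  · simp [commutatorElement_def]
  · have := hnormal N hN h _ (inv_mem (hpos g h hh h1))
    simpa [commutatorElement_def, mul_assoc] using this

end OrderedGroup

/-! ### Words in two letters and free submonoids -/

/-- The element of a group spelled by a word in the letters `x` and `y`. -/
def pairWord {G : Type v} [Group G] (x y : G) (l : List Bool) : G :=
  (l.map fun b => bif b then x else y).prod

/-- Words in `x` and `y` with distinct first letters spell distinct elements. -/
def IsFreePair {G : Type v} [Group G] (x y : G) : Prop :=
  ∀ l m : List Bool, x * pairWord x y l ≠ y * pairWord x y m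

section FreePair

variable {G : Type v} [Group G] {x y : G}

@[simp] theorem pairWord_nil : pairWord x y [] = 1 := rfl

@[simp] theorem pairWord_true_cons (l : List Bool) :
    pairWord x y (true :: l) = x * pairWord x y l := by simp [pairWord]

@[simp] theorem pairWord_false_cons (l : List Bool) :
    pairWord x y (false :: l) = y * pairWord x y l := by simp [pairWord]

theorem pairWord_append (l m : List Bool) :
    pairWord x y (l ++ m) = pairWord x y l * pairWord x y m := by simp [pairWord]

theorem map_pairWord {H : Type*} [Group H] (f : G →* H) (l : List Bool) :
    f (pairWord x y l) = pairWord (f x) (f y) l := by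
  induction l with
  | nil => simp
  | cons b l ih => cases b <;> simp [ih]

theorem pairWord_inv_inv (l : List Bool) :
    pairWord x⁻¹ y⁻¹ l = (pairWord x y l.reverse)⁻¹ := by
  induction l with
  | nil => simp
  | cons b l ih => cases b <;> simp [ih, pairWord_append]

namespace IsFreePair

theorem map {H : Type*} [Group H] (h : IsFreePair x y) (f : G →* H)
    (hf : Function.Injective f) : IsFreePair (f x) (f y) := by
  intro l m he
  rw [← map_pairWord, ← map_pairWord, ← map_mul, ← map_mul] at he
  exact h l m (hf he)

theorem pairWord_injective (h : IsFreePair x y) : Function.Injective (pairWord x y) := by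
  -- If a nonempty word were trivial, appending the letter other than its first would give a word
  -- equal to that single letter.
  have hnil : ∀ b l, pairWord x y (b :: l) ≠ 1 := by
    intro b l he
    cases b
    · exact h [] (l ++ [true]) (by
        rw [pairWord_append, ← mul_assoc, ← pairWord_false_cons, he]; simp)
    · exact h (l ++ [false]) [] (by
        rw [pairWord_append, ← mul_assoc, ← pairWord_true_cons, he]; simp)
  intro l
  induction l with
  | nil =>
    intro m he
    cases m with
    | nil => rfl
    | cons b m => exact absurd he.symm (hnil b m)
  | cons a l ih =>
    intro m he
    cases m with
    | nil => exact absurd he (hnil a l)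
    | cons b m =>
      cases a <;> cases b <;> simp only [pairWord_true_cons, pairWord_false_cons] at he
      · rw [ih (mul_left_cancel he)]
      · exact absurd he.symm (h m l)
      · exact absurd he (h l m)
      · rw [ih (mul_left_cancel he)]

/-- Inversion reverses words, so first letters become last letters; this is why injectivity on whole
words is needed. -/
protected theorem inv (h : IsFreePair x y) : IsFreePair x⁻¹ y⁻¹ := by
  intro l m he
  rw [← pairWord_true_cons, ← pairWord_false_cons, pairWord_inv_inv, pairWord_inv_inv,
    inv_inj] at he
  simpa using h.pairWord_injective he

protected theorem symm (h : IsFreePair x y) : IsFreePair y x := by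
  have hw : ∀ l, pairWord y x l = pairWord x y (l.map not) := by
    intro l
    induction l with
    | nil => simp
    | cons b l ih => cases b <;> simp [ih]
  intro l m he
  rw [hw, hw] at he
  exact h _ _ he.symm

/-- Expanding `y * x` turns words in the new letters into words in the old ones and keeps the first
letter. -/
theorem mul_left (h : IsFreePair x y) : IsFreePair x (y * x) := by
  have hw : ∀ l, ∃ m, pairWord x (y * x) l = pairWord x y m := by
    intro l
    induction l with
    | nil => exact ⟨[], by simp⟩
    | cons b l ih =>
      obtain ⟨m, hm⟩ := ih
      cases b
      · exact ⟨false :: true :: m, by simp [hm, mul_assoc]⟩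
      · exact ⟨true :: m, by simp [hm]⟩
  intro l m he
  obtain ⟨l', hl⟩ := hw l
  obtain ⟨m', hm⟩ := hw m
  rw [hl, hm, mul_assoc, ← pairWord_true_cons (x := x) (l := m')] at he
  exact h l' _ he

theorem ne_one_left (h : IsFreePair x y) : x ≠ 1 := fun h1 =>
  h [false] [] (by simp [h1])

/-- An ordered group with a free pair contains a free pair of positive elements. -/
theorem exists_one_lt [LinearOrder G] [IsBiordered G] (h : IsFreePair x y) :
    ∃ a b : G, 1 < a ∧ 1 < b ∧ IsFreePair a b := by
  have hneg : ∀ a b : G, a < 1 → b < 1 → IsFreePair a b →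
      ∃ a b : G, 1 < a ∧ 1 < b ∧ IsFreePair a b := fun a b ha hb hab =>
    ⟨a⁻¹, b⁻¹, one_lt_inv'.2 ha, one_lt_inv'.2 hb, hab.inv⟩
  -- The product `b * a` is not `1`. If it is positive, use `a, b * a`; otherwise its conjugate `a *
  -- b` is negative as well, and `b, a * b` can be inverted.
  have hmixed : ∀ a b : G, 1 < a → b < 1 → IsFreePair a b →
      ∃ a b : G, 1 < a ∧ 1 < b ∧ IsFreePair a b := by
    intro a b ha hb hab
    rcases lt_or_gt_of_ne hab.mul_left.symm.ne_one_left with h1 | h1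
    · refine hneg b (a * b) hb ?_ hab.symm.mul_left
      simpa using mul_lt_mul_left (mul_lt_mul_right h1 b⁻¹) b
    · exact ⟨a, b * a, ha, h1, hab.mul_left⟩
  rcases lt_or_gt_of_ne h.ne_one_left with hx | hx <;>
    rcases lt_or_gt_of_ne h.symm.ne_one_left with hy | hy
  · exact hneg x y hx hy h
  · exact hmixed y x hy hx h.symm
  · exact hmixed x y hx hy h
  · exact ⟨x, y, hx, hy, h⟩

/-- If `h > 1` and conjugation by `k` contracts `h ^ 2` below `h`, then `k` and `h * k` form a
free pair. -/
theorem of_conj_lt [LinearOrder G] [IsBiordered G] {k h : G} (h1 : 1 < h)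
    (hk : k * (h * h) < h * k) : IsFreePair k (h * k) := by
  -- A word of length `n` lies in the window from `k ^ n` to `h * h * k ^ n`. The contraction `k *
  -- (h * h) < h * k` preserves this window and, for equal lengths, puts words starting with `k`
  -- below those starting with `h * k`.
  have hbound : ∀ l : List Bool, k ^ l.length ≤ pairWord k (h * k) l ∧
      pairWord k (h * k) l < h * h * k ^ l.length := by
    intro l
    induction l with
    | nil => simpa using h1.trans (by simpa using mul_lt_mul_right h1 h)
    | cons b l ih =>
      obtain ⟨ih1, ih2⟩ := ih
      have e1 : k * pairWord k (h * k) l < h * k ^ (l.length + 1) := by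
        rw [pow_succ', ← mul_assoc]
        refine (mul_lt_mul_right ih2 k).trans ?_
        rw [← mul_assoc]
        exact mul_lt_mul_left hk _
      have e2 : k ^ (l.length + 1) ≤ k * pairWord k (h * k) l := by
        rw [pow_succ']; exact mul_le_mul_right ih1 k
      have e3 : ∀ z : G, z < h * z := fun z => by simpa using mul_lt_mul_left h1 z
      cases b
      · simp only [pairWord_false_cons, List.length_cons, mul_assoc]
        exact ⟨e2.trans (e3 _).le, mul_lt_mul_right e1 h⟩
      · simp only [pairWord_true_cons, List.length_cons, mul_assoc]
        exact ⟨e2, e1.trans (e3 _)⟩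
  have hlen : ∀ l m : List Bool, l.length = m.length →
      k * pairWord k (h * k) l < h * k * pairWord k (h * k) m := by
    intro l m hlm
    calc k * pairWord k (h * k) l < k * (h * h * k ^ l.length) :=
          mul_lt_mul_right (hbound l).2 k
      _ < h * k * k ^ l.length := by rw [← mul_assoc]; exact mul_lt_mul_left hk _
      _ ≤ h * k * pairWord k (h * k) m := by rw [hlm]; exact mul_le_mul_right (hbound m).1 _
  intro l m he
  -- Lengths are equalized by multiplying the two supposedly equal words in both orders.
  have := hlen (l ++ false :: m) (m ++ true :: l) (by simp; omega)
  rw [pairWord_append, pairWord_append, ← mul_assoc, ← mul_assoc, pairWord_true_cons,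
    pairWord_false_cons, he] at this
  exact lt_irrefl _ this

end IsFreePair

end FreePair

/-- Noncentrality supplies `h * h < g * h * g⁻¹`; left multiplication by `k = g⁻¹` makes it `k * (h
* h) < h * k`. -/
theorem exists_isFreePair_of_not_isCentralOrder {G : Type v} [Group G] [LinearOrder G]
    [IsBiordered G] (hG : ¬ IsCentralOrder G) : ∃ x y : G, IsFreePair x y := by
  by_contra hno
  push Not at hno
  refine hG (isCentralOrder_of_conj_le fun g h h1 => ?_)
  by_contra hlt
  refine hno g⁻¹ (h * g⁻¹) (IsFreePair.of_conj_lt h1 ?_)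
  simpa [mul_assoc] using mul_lt_mul_right (not_le.1 hlt) g⁻¹

/-- An ordered group outside `C₂` contains a free pair of positive elements. -/
theorem exists_positive_isFreePair_of_not_inClassCTwo {G : Type v} [Group G] [LinearOrder G]
    [IsBiordered G] (hG : ¬ InClassCTwo G) :
    ∃ x y : G, 1 < x ∧ 1 < y ∧ IsFreePair x y := by
  have ho : IsOrderable G := ⟨_, ‹IsBiordered G›⟩
  simp only [InClassCTwo, not_and, not_forall] at hG
  obtain ⟨a, b, o, hbi, hcent⟩ := hG ho
  -- The order `o` need not be induced from `G`. Only the freeness of the pair is carried over;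
  -- positivity is arranged afterwards for the order of `G`.
  obtain ⟨x, y, hxy⟩ := @exists_isFreePair_of_not_isCentralOrder _ _ o hbi hcent
  exact (hxy.map (Subgroup.subtype _) (Subgroup.subtype_injective _)).exists_one_lt

/-! ### The group algebra of a free group -/

section FreeGroupAlgebra

open MonoidAlgebra

variable {Z ι : Type*} [CommRing Z]

/-- The element of the group algebra of a free group given by a word. -/
noncomputable def wordMonomial (Z : Type*) [CommRing Z] {ι : Type*} (L : List (ι × Bool)) :
    MonoidAlgebra Z (FreeGroup ι) := of Z (FreeGroup ι) (FreeGroup.mk L)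

theorem wordMonomial_append (L M : List (ι × Bool)) :
    wordMonomial Z (L ++ M) = wordMonomial Z L * wordMonomial Z M := by
  rw [wordMonomial, ← FreeGroup.mul_mk, map_mul]; rfl

theorem wordMonomial_nil : wordMonomial Z ([] : List (ι × Bool)) = 1 :=
  map_one (of Z (FreeGroup ι))

theorem wordMonomial_mul_not_cons (i : ι) (b : Bool) (L : List (ι × Bool)) :
    wordMonomial Z [(i, b)] * wordMonomial Z ((i, !b) :: L) = wordMonomial Z L := by
  rw [← wordMonomial_append, wordMonomial, wordMonomial]
  congr 1
  exact Quot.sound (FreeGroup.Red.Step.cons_not (L := L))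

variable [Fintype ι] [DecidableEq ι]

/-- Fox's formula for a word: the coefficients are supported on proper suffixes of the word and on
suffixes which begin with a letter of sign opposite to `b`. -/
theorem exists_fox_derivative_word (b : Bool) (L : List (ι × Bool)) :
    ∃ β : ι → MonoidAlgebra Z (FreeGroup ι),
      (∀ i, β i ∈ Submodule.span Z (wordMonomial Z '' {M | M <:+ L ∧
        (M.length < L.length ∨ ∃ j, M.head? = some (j, !b))})) ∧
      wordMonomial Z L = 1 + ∑ i, (wordMonomial Z [(i, b)] - 1) * β i := by
  induction L with
  | nil => exact ⟨0, by simp, by simp [wordMonomial_nil]⟩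
  | cons p L ih =>
    obtain ⟨j, c⟩ := p
    obtain ⟨β, hβ, he⟩ := ih
    have hβ' : ∀ i, β i ∈ Submodule.span Z (wordMonomial Z '' {M | M <:+ (j, c) :: L ∧
        (M.length < ((j, c) :: L).length ∨ ∃ j, M.head? = some (j, !b))}) := by
      refine fun i => Submodule.span_mono (Set.image_mono ?_) (hβ i)
      rintro M ⟨hM, -⟩
      refine ⟨hM.trans (List.suffix_cons _ _), Or.inl ?_⟩
      have := hM.length_le
      simp only [List.length_cons]; omega
    have hsum : ∀ m : MonoidAlgebra Z (FreeGroup ι),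
        ∑ i, (wordMonomial Z [(i, b)] - 1) * (β i + (Pi.single j m : ι → _) i) =
        ∑ i, (wordMonomial Z [(i, b)] - 1) * β i + (wordMonomial Z [(j, b)] - 1) * m := by
      intro m
      simp only [mul_add, Finset.sum_add_distrib]
      congr 1
      rw [Finset.sum_eq_single j]
      · simp
      · intro i _ hi; simp [hi]
      · simp
    have hmem : ∀ M : List (ι × Bool), (M <:+ (j, c) :: L ∧
        (M.length < ((j, c) :: L).length ∨ ∃ j, M.head? = some (j, !b))) → ∀ r : Z, ∀ i,
        β i + (Pi.single j (r • wordMonomial Z M) : ι → _) i ∈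
        Submodule.span Z (wordMonomial Z '' {M | M <:+ (j, c) :: L ∧
        (M.length < ((j, c) :: L).length ∨ ∃ j, M.head? = some (j, !b))}) := by
      intro M hM r i
      refine add_mem (hβ' i) ?_
      by_cases hi : i = j
      · subst hi
        rw [Pi.single_eq_same]
        exact Submodule.smul_mem _ r (Submodule.subset_span (Set.mem_image_of_mem _ hM))
      · simp [hi]
    -- With `t` the letter `(j, b)`: `t L = L + (t - 1) L` if the signs agree, and `t⁻¹ L = L - (t -
    -- 1) t⁻¹ L` if not. Only the second puts the full word into a coefficient.
    by_cases hc : c = b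
    · subst hc
      refine ⟨_, hmem L ⟨List.suffix_cons _ _, Or.inl (by simp)⟩ 1, ?_⟩
      rw [hsum, one_smul, sub_mul, ← wordMonomial_append, List.singleton_append, one_mul,
        ← add_assoc, ← he]
      abel
    · have hc' : c = !b := by cases c <;> cases b <;> simp_all
      subst hc'
      refine ⟨_, hmem ((j, !b) :: L) ⟨List.suffix_refl _, Or.inr ⟨j, rfl⟩⟩ (-1), ?_⟩
      rw [hsum, neg_one_smul, mul_neg, sub_mul, wordMonomial_mul_not_cons, one_mul,
        ← add_assoc, ← he]
      abel

/-- Choosing `b` as the sign of the first letter of `l` removes `l` from the coefficients: no word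
of `T` is long enough to have `l` as a proper suffix, and `l` does not begin with the opposite sign.
This makes the induction on `T` descend. -/
theorem exists_fox_derivative (b : Bool) (T : Set (List (ι × Bool))) (l : List (ι × Bool))
    (hT : ∀ L ∈ T, ∀ M, M <:+ L → M ∈ T) (hlen : ∀ L ∈ T, L.length ≤ l.length)
    (hl : ∃ j, l.head? = some (j, b)) {α : MonoidAlgebra Z (FreeGroup ι)}
    (hα : α ∈ Submodule.span Z (wordMonomial Z '' T)) :
    ∃ (s : Z) (β : ι → MonoidAlgebra Z (FreeGroup ι)),
      (∀ i, β i ∈ Submodule.span Z (wordMonomial Z '' (T \ {l}))) ∧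
      α = algebraMap Z _ s + ∑ i, (wordMonomial Z [(i, b)] - 1) * β i := by
  induction hα using Submodule.span_induction with
  | mem α hα =>
    obtain ⟨L, hL, rfl⟩ := hα
    obtain ⟨β, hβ, he⟩ := exists_fox_derivative_word (Z := Z) b L
    refine ⟨1, β, fun i => Submodule.span_mono (Set.image_mono ?_) (hβ i), by rw [map_one, he]⟩
    rintro M ⟨hM, hM'⟩
    refine ⟨hT L hL M hM, ?_⟩
    rintro rfl
    rcases hM' with h | ⟨j, h⟩
    · exact absurd (hlen L hL) (not_le.2 h)
    · obtain ⟨j', h'⟩ := hl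
      rw [h] at h'
      simp at h'
  | zero => exact ⟨0, 0, by simp, by simp⟩
  | add α α' _ _ h h' =>
    obtain ⟨s, β, hβ, rfl⟩ := h
    obtain ⟨s', β', hβ', rfl⟩ := h'
    refine ⟨s + s', β + β', fun i => add_mem (hβ i) (hβ' i), ?_⟩
    simp only [map_add, Pi.add_apply, mul_add, Finset.sum_add_distrib]
    abel
  | smul r α _ h =>
    obtain ⟨s, β, hβ, rfl⟩ := h
    refine ⟨r * s, r • β, fun i => Submodule.smul_mem _ r (hβ i), ?_⟩
    simp only [Pi.smul_apply, mul_smul_comm, smul_add, Finset.smul_sum, map_mul,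
      Algebra.smul_def r (algebraMap Z (MonoidAlgebra Z (FreeGroup ι)) s)]

/-- A homomorphism from the group algebra of a free group is injective if the elements
`φ (t i) - 1` are independent, together with the scalars, from the left over its image. -/
theorem freeGroupAlgebra_injective {E : Type*} [Ring E] [Algebra Z E]
    (φ : MonoidAlgebra Z (FreeGroup ι) →ₐ[Z] E)
    (hφ : ∀ (s : Z) (β : ι → MonoidAlgebra Z (FreeGroup ι)),
      algebraMap Z E s + ∑ i, (φ (wordMonomial Z [(i, true)]) - 1) * φ (β i) = 0 →
        s = 0 ∧ ∀ i, φ (β i) = 0) : Function.Injective φ := by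
  have hunit : ∀ i b, wordMonomial Z [(i, b)] * wordMonomial Z [(i, !b)] =
      (1 : MonoidAlgebra Z (FreeGroup ι)) := fun i b => by
    rw [wordMonomial_mul_not_cons, wordMonomial_nil]
  -- Independence passes to inverse letters, since `t⁻¹ - 1 = -(t - 1) t⁻¹` and the factor `t⁻¹` can
  -- be absorbed into the coefficient.
  have hφ' : ∀ (b : Bool) (s : Z) (β : ι → MonoidAlgebra Z (FreeGroup ι)),
      φ (algebraMap Z _ s + ∑ i, (wordMonomial Z [(i, b)] - 1) * β i) = 0 →
        s = 0 ∧ ∀ i, φ (β i) = 0 := by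
    intro b s β h
    cases b
    · have h' := hφ s (fun i => -(wordMonomial Z [(i, false)] * β i)) (by
        rw [← h]
        simp only [map_add, map_sum, AlgHom.commutes, ← map_one φ, ← map_sub, ← map_mul]
        congr 1
        refine Finset.sum_congr rfl fun i _ => ?_
        congr 1
        rw [mul_neg, sub_mul, ← mul_assoc]
        have := hunit i true
        simp only [Bool.not_true] at this
        rw [this, sub_mul, one_mul, one_mul, neg_sub])
      refine ⟨h'.1, fun i => ?_⟩
      have h2 : β i = -(wordMonomial Z [(i, true)] * -(wordMonomial Z [(i, false)] * β i)) := by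
        have := hunit i true
        simp only [Bool.not_true] at this
        rw [mul_neg, neg_neg, ← mul_assoc, this, one_mul]
      rw [h2, map_neg, map_mul, h'.2 i, mul_zero, neg_zero]
    · refine hφ s β (by
        simpa only [map_add, map_sum, AlgHom.commutes, map_mul, map_sub, map_one] using h)
  -- Induction on the size of a suffix-closed set of words, not necessarily reduced. A Fox expansion
  -- adapted to a longest word leaves coefficients in the kernel that avoid that word, and removing
  -- a longest word keeps the set suffix-closed.
  have main : ∀ (n : ℕ) (T : Finset (List (ι × Bool))), T.card = n →
      (∀ L ∈ T, ∀ M, M <:+ L → M ∈ T) → ∀ α : MonoidAlgebra Z (FreeGroup ι),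
      α ∈ Submodule.span Z (wordMonomial Z '' (T : Set (List (ι × Bool)))) → φ α = 0 →
      α = 0 := by
    intro n
    induction n with
    | zero =>
      intro T hcard _ α hα _
      rw [Finset.card_eq_zero] at hcard
      subst hcard
      simpa using hα
    | succ n ih =>
      intro T hcard hT α hα hker
      obtain ⟨l, hl, hmax⟩ := T.exists_max_image List.length
        (Finset.card_pos.1 (by omega))
      match l, hl, hmax with
      | [], hl, hmax =>
        have hsub : (T : Set (List (ι × Bool))) ⊆ {[]} := fun L hL => by
          simpa using hmax L hL
        have hα' := Submodule.span_mono (Set.image_mono hsub) hα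
        rw [Set.image_singleton, Submodule.mem_span_singleton, wordMonomial_nil] at hα'
        obtain ⟨s, rfl⟩ := hα'
        have := (hφ s 0 (by simpa [Algebra.algebraMap_eq_smul_one] using hker)).1
        simp [this]
      | (j, b) :: w, hl, hmax =>
        obtain ⟨s, β, hβ, rfl⟩ := exists_fox_derivative b (T : Set (List (ι × Bool)))
          ((j, b) :: w) hT hmax ⟨j, rfl⟩ hα
        obtain ⟨rfl, hβ0⟩ := hφ' b s β hker
        have hz : ∀ i, β i = 0 := by
          intro i
          refine ih (T.erase ((j, b) :: w)) (by rw [Finset.card_erase_of_mem hl]; omega) ?_ _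
            (by simpa using hβ i) (hβ0 i)
          intro L hL M hM
          rw [Finset.mem_erase] at hL ⊢
          refine ⟨?_, hT L hL.2 M hM⟩
          rintro rfl
          exact hL.1 (hM.eq_of_length_le (hmax L hL.2)).symm
        simp [hz]
  rw [injective_iff_map_eq_zero]
  intro α hα
  let T : Finset (List (ι × Bool)) :=
    α.coeff.support.biUnion fun f => f.toWord.tails.toFinset
  refine main _ T rfl ?_ α ?_ hα
  · intro L hL M hM
    simp only [T, Finset.mem_biUnion, List.mem_toFinset, List.mem_tails] at hL ⊢
    obtain ⟨f, hf, hL⟩ := hL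
    exact ⟨f, hf, hM.trans hL⟩
  · refine Submodule.span_mono ?_ (MonoidAlgebra.mem_span_support_coeff α)
    rintro _ ⟨f, hf, rfl⟩
    refine ⟨f.toWord, ?_, by rw [wordMonomial, FreeGroup.mk_toWord]⟩
    simp only [T, Finset.coe_biUnion, Set.mem_iUnion]
    exact ⟨f, hf, by simp⟩

end FreeGroupAlgebra

/-! ### Malcev-Neumann series supported in a submonoid -/

section FreePairCenter

variable {G : Type v} [Group G] {x y : G}

/-- The products of a central element and a word in `x` and `y`. -/
def centerMulPair (x y : G) : Submonoid G where
  carrier := {g | ∃ c ∈ Subgroup.center G, ∃ l, g = c * pairWord x y l}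
  one_mem' := ⟨1, one_mem _, [], by simp⟩
  mul_mem' := by
    rintro _ _ ⟨c, hc, l, rfl⟩ ⟨d, hd, m, rfl⟩
    refine ⟨c * d, mul_mem hc hd, l ++ m, ?_⟩
    rw [pairWord_append, mul_assoc, ← mul_assoc _ d, Subgroup.mem_center_iff.1 hd]
    simp only [mul_assoc]

theorem pairWord_mem_centerMulPair (l : List Bool) : pairWord x y l ∈ centerMulPair x y :=
  ⟨1, one_mem _, l, by simp⟩

/-- An equality would make a word starting with `x` a central multiple of a word starting with `y`.
The two words would then commute, and their products in the two orders would violate freeness. -/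
theorem IsFreePair.mul_ne_of_mem_centerMulPair (h : IsFreePair x y) {p q : G}
    (hp : p ∈ centerMulPair x y) (hq : q ∈ centerMulPair x y) : x * p ≠ y * q := by
  obtain ⟨c, hc, l, rfl⟩ := hp
  obtain ⟨d, hd, m, rfl⟩ := hq
  intro he
  have hc' := Subgroup.mem_center_iff.1 hc
  have hd' := Subgroup.mem_center_iff.1 hd
  rw [← mul_assoc, ← mul_assoc, hc', hd', mul_assoc, mul_assoc] at he
  have hz : c⁻¹ * d ∈ Subgroup.center G := mul_mem (inv_mem hc) hd
  have he' : x * pairWord x y l = (c⁻¹ * d) * (y * pairWord x y m) := by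
    rw [mul_assoc, ← he]; group
  refine h (l ++ false :: m) (m ++ true :: l) ?_
  rw [pairWord_append, pairWord_append, ← mul_assoc, ← mul_assoc, pairWord_true_cons,
    pairWord_false_cons, he', ← mul_assoc _ (c⁻¹ * d), Subgroup.mem_center_iff.1 hz]

/-- Otherwise a word starting with `x` would commute with `y`, equating words with different first
letters. -/
theorem IsFreePair.mul_notMem_center (h : IsFreePair x y) {p : G}
    (hp : p ∈ centerMulPair x y) : x * p ∉ Subgroup.center G := by
  obtain ⟨c, hc, l, rfl⟩ := hp
  intro hz
  have hw : x * pairWord x y l ∈ Subgroup.center G := by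
    have := mul_mem (inv_mem hc) hz
    rwa [← mul_assoc x, Subgroup.mem_center_iff.1 hc, mul_assoc, inv_mul_cancel_left] at this
  refine h (l ++ [false]) (true :: l) ?_
  have := Subgroup.mem_center_iff.1 hw y
  rw [pairWord_append, pairWord_true_cons, this]
  simp [mul_assoc]

end FreePairCenter

namespace MNSeries

open CrossedSystem

variable {K : Type u} [DivisionRing K] {G : Type v} [Group G] [LinearOrder G]
  {S : CrossedSystem K G}

theorem one_add_bar_ne_zero {g : G} (hg : 1 < g) : 1 + single S g 1 ≠ 0 := by
  intro h
  have := congrArg (fun f => f.coeff 1) h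
  simp [one_def, coeff_single, hg.ne] at this

variable [IsBiordered G]

theorem coeff_bar_mul_ne_zero (g : G) (f : MNSeries S) (h : G) :
    (single S g 1 * f).coeff h ≠ 0 ↔ f.coeff (g⁻¹ * h) ≠ 0 := by
  simp [coeff_single_mul]

theorem coeff_mul_bar_ne_zero (g : G) (f : MNSeries S) (h : G) :
    (f * single S g 1).coeff h ≠ 0 ↔ f.coeff (h * g⁻¹) ≠ 0 := by
  simp [coeff_mul_single]

/-- The series supported in a submonoid. -/
def supportedIn (S : CrossedSystem K G) (P : Submonoid G) : Subring (MNSeries S) where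
  carrier := {f | ∀ g, f.coeff g ≠ 0 → g ∈ P}
  mul_mem' {f f'} hf hf' g hg := by
    obtain ⟨h, hh⟩ := exists_mulTerm_ne_zero hg
    obtain ⟨h1, h2⟩ := mulTerm_ne_zero.1 hh
    simpa using mul_mem (hf _ h1) (hf' _ h2)
  one_mem' g hg := by
    rw [one_def, coeff_single] at hg
    simp only [ne_eq, ite_eq_right_iff, not_forall] at hg
    exact hg.1 ▸ one_mem P
  add_mem' {f f'} hf hf' g hg := by
    by_cases h : f.coeff g = 0
    · exact hf' g (by simpa [h] using hg)
    · exact hf g h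
  zero_mem' g hg := absurd rfl hg
  neg_mem' {f} hf g hg := hf g (by simpa using hg)

theorem mem_supportedIn {P : Submonoid G} {f : MNSeries S} :
    f ∈ supportedIn S P ↔ ∀ g, f.coeff g ≠ 0 → g ∈ P := Iff.rfl

theorem bar_mem_supportedIn {P : Submonoid G} {g : G} (hg : g ∈ P) :
    single S g 1 ∈ supportedIn S P := by
  intro h hh
  rw [coeff_single] at hh
  simp only [ne_eq, ite_eq_right_iff, not_forall] at hh
  exact hh.1 ▸ hg

/-- The inverse satisfies `f = 1 - ḡ f`. If `m` were the least support element outside `P`, then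
`g⁻¹ * m` would be a smaller one. -/
theorem inv_one_add_bar_mem_supportedIn {P : Submonoid G} {g : G} (hg : g ∈ P) (h1 : 1 < g) :
    (1 + single S g 1)⁻¹ ∈ supportedIn S P := by
  set f := (1 + single S g 1)⁻¹ with hf
  have hrec : f = 1 - single S g 1 * f := by
    have : (1 + single S g 1) * f = 1 := mul_inv_cancel₀ (one_add_bar_ne_zero h1)
    rw [eq_sub_iff_add_eq, ← this, add_mul, one_mul]
  rw [mem_supportedIn]
  by_contra hne
  push Not at hne
  have hwf : {h | f.coeff h ≠ 0 ∧ h ∉ P}.IsWF := f.isWF_support.mono fun h hh => hh.1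
  set m := hwf.min hne with hm
  obtain ⟨hm1, hm2⟩ : f.coeff m ≠ 0 ∧ m ∉ P := hwf.min_mem hne
  have hm3 : f.coeff (g⁻¹ * m) ≠ 0 := by
    rw [← coeff_bar_mul_ne_zero]
    intro h0
    apply hm1
    rw [hrec, sub_eq_add_neg, coeff_add, coeff_neg, h0, one_def, coeff_single, if_neg]
    · simp
    · intro h
      exact hm2 (h ▸ one_mem P)
  have hm4 : g⁻¹ * m ∉ P := fun h => hm2 (by simpa using mul_mem hg h)
  refine absurd (hwf.min_le hne ⟨hm3, hm4⟩) (not_le.2 ?_)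
  calc g⁻¹ * m < 1 * m := mul_lt_mul_left (inv_lt_one'.2 h1) m
    _ = m := one_mul m

/-- A series which commutes with all `ḡ` is supported in the center of the group: its support is
well-ordered and invariant under conjugation. -/
theorem mem_center_of_commute_bar {f : MNSeries S}
    (hf : ∀ g, single S g 1 * f = f * single S g 1) {c : G} (hc : f.coeff c ≠ 0) :
    c ∈ Subgroup.center G := by
  have hconj : ∀ g c, f.coeff c ≠ 0 → f.coeff (g * c * g⁻¹) ≠ 0 := by
    intro g c hc
    rw [← coeff_mul_bar_ne_zero, ← hf, coeff_bar_mul_ne_zero]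
    simpa using hc
  -- The least support element decreased by conjugation with `g` would have as conjugate a smaller
  -- support element of the same kind. Applying the bound to `g` and `g⁻¹` gives equality.
  have hle : ∀ g c, f.coeff c ≠ 0 → c ≤ g * c * g⁻¹ := by
    intro g c hc
    by_contra hlt
    have hne : {d | f.coeff d ≠ 0 ∧ g * d * g⁻¹ < d}.Nonempty := ⟨c, hc, not_le.1 hlt⟩
    have hwf : {d | f.coeff d ≠ 0 ∧ g * d * g⁻¹ < d}.IsWF :=
      f.isWF_support.mono fun d hd => hd.1
    obtain ⟨h1, h2⟩ := hwf.min_mem hne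
    refine absurd (hwf.min_le hne ⟨hconj g _ h1, ?_⟩) (not_le.2 h2)
    exact mul_lt_mul_left (mul_lt_mul_right h2 g) g⁻¹
  rw [Subgroup.mem_center_iff]
  intro g
  have h1 := hle g c hc
  have h2 := hle g⁻¹ _ (hconj g c hc)
  have h3 : g * c * g⁻¹ = c := le_antisymm (by simpa [mul_assoc] using h2) h1
  exact mul_inv_eq_iff_eq_mul.1 h3

/-- The three summands have pairwise disjoint supports, in the center, `x P` and `y P` with `P =
centerMulPair x y`. No cancellation is possible, and left multiplication by `x̄` or `ȳ` only moves
the support. -/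
theorem eq_zero_of_add_bar_mul_eq_zero {x y : G} (h : IsFreePair x y) {s a b : MNSeries S}
    (hs : ∀ g, s.coeff g ≠ 0 → g ∈ Subgroup.center G)
    (ha : a ∈ supportedIn S (centerMulPair x y)) (hb : b ∈ supportedIn S (centerMulPair x y))
    (h0 : s + (single S x 1 * a + single S y 1 * b) = 0) : s = 0 ∧ a = 0 ∧ b = 0 := by
  have hcoeff : ∀ g, s.coeff g + ((single S x 1 * a).coeff g + (single S y 1 * b).coeff g) = 0 :=
    fun g => congrArg (fun f => f.coeff g) h0
  have hsymm : ∀ g, g ∈ centerMulPair x y → y * g ∉ Subgroup.center G := by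
    rintro _ ⟨c, hc, l, rfl⟩
    intro hz
    have hx := Subgroup.mem_center_iff.1 hz x
    refine h.mul_ne_of_mem_centerMulPair (p := y * (c * pairWord x y l))
      (q := c * pairWord x y l * x) ?_ ?_ (by rw [hx]; simp only [mul_assoc])
    · exact mul_mem (by simpa using pairWord_mem_centerMulPair (x := x) (y := y) [false])
        ⟨c, hc, l, rfl⟩
    · exact mul_mem ⟨c, hc, l, rfl⟩
        (by simpa using pairWord_mem_centerMulPair (x := x) (y := y) [true])
  have ha0 : a = 0 := by
    ext g
    by_contra hg
    have hgP := ha g hg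
    have h1 : s.coeff (x * g) = 0 := by
      by_contra hne
      exact h.mul_notMem_center hgP (hs _ hne)
    have h2 : (single S y 1 * b).coeff (x * g) = 0 := by
      by_contra hne
      refine h.mul_ne_of_mem_centerMulPair hgP (hb _ ((coeff_bar_mul_ne_zero _ _ _).1 hne)) ?_
      simp
    have h3 := hcoeff (x * g)
    rw [h1, h2, zero_add, add_zero] at h3
    exact (coeff_bar_mul_ne_zero x a (x * g)).2 (by simpa using hg) h3
  have hb0 : b = 0 := by
    ext g
    by_contra hg
    have h1 : s.coeff (y * g) = 0 := by
      by_contra hne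
      exact hsymm g (hb g hg) (hs _ hne)
    have h3 := hcoeff (y * g)
    rw [h1, ha0, mul_zero, coeff_zero, zero_add, zero_add] at h3
    exact (coeff_bar_mul_ne_zero y b (y * g)).2 (by simpa using hg) h3
  exact ⟨by simpa [ha0, hb0] using h0, ha0, hb0⟩

end MNSeries

/-! ### The free group algebra inside the skew field of fractions -/

namespace CrossedSystem

open MNSeries

variable {K : Type u} [DivisionRing K] {G : Type v} [Group G] [LinearOrder G]
  [IsBiordered G] (S : CrossedSystem K G)

theorem bar_mem_skewFractions (g : G) : single S g 1 ∈ S.skewFractions :=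
  Subfield.subset_closure ((Set.finite_singleton g).subset Pi.support_single_subset)

/-- The element `ḡ` of the skew field of fractions. -/
noncomputable def bar (g : G) : S.skewFractions := ⟨single S g 1, S.bar_mem_skewFractions g⟩

@[simp] theorem coe_bar (g : G) : (S.bar g : MNSeries S) = single S g 1 := rfl

theorem mem_center_of_mem_center_skewFractions (z : Subring.center S.skewFractions) {g : G}
    (hg : ((z : S.skewFractions) : MNSeries S).coeff g ≠ 0) : g ∈ Subgroup.center G :=
  mem_center_of_commute_bar
    (fun h => congrArg Subtype.val (Subring.mem_center_iff.1 z.2 (S.bar h))) hg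

/-- The generators are `1 + x̄` and `1 + ȳ` because, for `x, y > 1`, their inverses are still
supported in words in `x` and `y`, whereas the inverse of `x̄` has support `{x⁻¹}`. -/
theorem containsFreeGroupAlgebra_of_isFreePair {x y : G} (hx : 1 < x) (hy : 1 < y)
    (hxy : IsFreePair x y) : ContainsFreeGroupAlgebraOverCenter S.skewFractions := by
  let w : Bool → G := fun i => bif i then x else y
  have hw : ∀ i, 1 < w i := by intro i; cases i <;> assumption
  let P := centerMulPair x y
  have hwP : ∀ i, w i ∈ P := by
    intro i
    have := pairWord_mem_centerMulPair (x := x) (y := y) [i]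
    cases i <;> simpa [w, P] using this
  have hne : ∀ i, 1 + S.bar (w i) ≠ 0 := fun i h =>
    one_add_bar_ne_zero (S := S) (hw i) (congrArg Subtype.val h)
  let t : Bool → (S.skewFractions)ˣ := fun i => Units.mk0 _ (hne i)
  let φ : MonoidAlgebra (Subring.center S.skewFractions) (FreeGroup Bool)
      →ₐ[Subring.center S.skewFractions] S.skewFractions :=
    MonoidAlgebra.lift _ _ _ ((Units.coeHom S.skewFractions).comp (FreeGroup.lift t))
  have hφof : ∀ f, φ (MonoidAlgebra.of _ _ f) = (FreeGroup.lift t f : S.skewFractions) :=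
    fun f => MonoidAlgebra.lift_of _ f
  -- This is why central factors were admitted in `P`: scalars from the center of the skew field
  -- must be supported there.
  have hz : ∀ z : Subring.center S.skewFractions,
      ((z : S.skewFractions) : MNSeries S) ∈ supportedIn S P := fun z g hg =>
    ⟨g, S.mem_center_of_mem_center_skewFractions z hg, [], by simp⟩
  have hF : ∀ f, ((FreeGroup.lift t f : S.skewFractions) : MNSeries S) ∈ supportedIn S P := by
    intro f
    induction f using FreeGroup.induction_on with
    | C1 => simp
    | of i => simpa [t] using add_mem (one_mem _) (bar_mem_supportedIn (hwP i))
    | inv_of i _ => simpa [t] using inv_one_add_bar_mem_supportedIn (hwP i) (hw i)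
    | mul f f' h h' => simpa using mul_mem h h'
  have hφP : ∀ a, ((φ a : S.skewFractions) : MNSeries S) ∈ supportedIn S P := by
    intro a
    induction a using MonoidAlgebra.induction_on with
    | of f => rw [hφof]; exact hF f
    | add a b ha hb => rw [map_add]; exact add_mem ha hb
    | smul z a ha => rw [map_smul]; exact mul_mem (hz z) ha
  refine ⟨Bool, inferInstance, φ, freeGroupAlgebra_injective φ fun s β h0 => ?_⟩
  have hbar : ∀ i, φ (wordMonomial _ [(i, true)]) - 1 = S.bar (w i) := by
    intro i
    rw [wordMonomial, hφof]
    simp [t]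
  simp only [hbar, Fintype.sum_bool] at h0
  obtain ⟨h1, h2, h3⟩ := eq_zero_of_add_bar_mul_eq_zero hxy
    (fun g hg => S.mem_center_of_mem_center_skewFractions s hg) (hφP (β true))
    (hφP (β false))
    (congrArg Subtype.val h0)
  refine ⟨Subtype.ext (Subtype.ext h1), fun i => ?_⟩
  cases i
  · exact Subtype.ext h3
  · exact Subtype.ext h2

end CrossedSystem

theorem mainTheorem5 {G : Type v} [Group G] [LinearOrder G] [IsBiordered G]
    (hG : ¬ InClassCTwo G) {K : Type u} [DivisionRing K] (S : CrossedSystem K G) :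
    ContainsFreeGroupAlgebraOverCenter S.skewFractions := by
  obtain ⟨x, y, hx, hy, hxy⟩ := exists_positive_isFreePair_of_not_inClassCTwo hG
  exact S.containsFreeGroupAlgebra_of_isFreePair hx hy hxy
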